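/- Conventions. All logarithms are to base $2$. Let $X=\{0,1\}^*$ be the discrete space of finite binary strings (with the metric $d(x,y)=1$ for $x\neq y$), $\Lambda$ the empty string, and $\mathcal M$ the set of probability measures on $X$ with the weak topology. $\mathcal M$ is given the enumerated subbase of the sets $\{\mu:\mu f<r\}$ and $\{\mu:\mu f>r\}$, where $\mu f=\int f\,d\mu$, $r$ is rational, and $f$ is a minimum of finitely many of the functions $g_{u,r,1/k}(x)=\bigl|1-k\,|d(x,u)-r|^+\bigr|^+$ ($u\in X$, $r\in\mathbb Q$, $k\ge 1$, $|a|^+=\max(a,0)$). A set is r.e. open if it is the union of a recursively enumerable family of finite intersections of subbase elements (products have the natural subbase). A measure $\mu\in\mathcal M$ is computable if the set of (indices of) subbase elements containing it is recursively enumerable. An interpreter is a partial computable function $A:\{0,1\}^*\times\{0,1\}^*\to\{0,1\}^*$ such that for each $y$ the domain of $A(\cdot,y)$ is prefix-free; $H^A(x\mid y)=\min\{|p|:A(p,y)=x\}$. An interpreter $T$ is optimal if for every interpreter $A$ there is a constant $c_A$ with $H^T(x\mid y)\le H^A(x\mid y)+c_A$ for all $x,y$. Given an optimal $T$, put $H(x)=H^T(x\mid\Lambda)$,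 and for $n\in\mathbb N$ let $H(n)$ be $H$ of the binary expansion of $n$. A uniform test is a function $f:\mathcal M\times X\to[0,\infty]$, $(\mu,x)\mapsto f_\mu(x)$, that is lower semicomputable (that is, $\{((\mu,x),r): r\in\mathbb Q,\ f_\mu(x)>r\}$ is r.e. open) and satisfies $\sum_x\mu(x)f_\mu(x)\le 1$ for all $\mu\in\mathcal M$. A uniform test $t$ is universal if for every uniform test $f$ there is $c>0$ with $c f_\mu(x)\le t_\mu(x)$ for all $\mu,x$. Given a universal test $t$, put $d_\mu(x)=\log t_\mu(x)$. Proposition. There is a non-computable probability measure $\mu$ on $X$ such that for every optimal interpreter $T$ and every universal uniform test $t$ the following hold. (1) There is a constant $c$ such that for each $n\in\mathbb N$ there is an $x\in X$ with $$|d_\mu(x)-(n-H(n))|\le c\qquad\text{and}\qquad -\log\mu(x)-H(x)\le c.$$ (2) Consequently $d_\mu(x)$ exceeds $-\log\mu(x)-H(x)$ by an unbounded amount: for every $c\in\mathbb R$ there is $x\in X$ with $d_\mu(x)>-\log\mu(x)-H(x)+c$. In particular, the function $(\nu,x)\mapsto 2^{-\log\nu(x)-H(x)}$ is not a universal uniform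 test. -/

import Mathlib

open scoped ENNReal NNReal

namespace UniformTest

/-! ### Prefix-free description complexity -/

/-- The set of finite binary strings. -/
abbrev Str : Type := List Bool

/-- A (prefix-free) interpreter: a partial computable function `A (p, y)` such that, for each `y`,
no program on which `A (·, y)` is defined is a prefix of a different such program. -/
structure IsInterpreter (A : Str → Str →. Str) : Prop where
  partrec : Partrec₂ A
  prefixFree : ∀ (y p₁ p₂ : Str), (A p₁ y).Dom → (A p₂ y).Dom → p₁ ≠ p₂ → ¬ p₁ <+: p₂

/-- `H^A (x | y) = min {|p| : A (p, y) = x}`, equal to `∞` if there is no such `p`. -/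
noncomputable def condComplexity (A : Str → Str →. Str) (x y : Str) : ℕ∞ :=
  ⨅ (p : Str) (_ : x ∈ A p y), (p.length : ℕ∞)

/-- An optimal interpreter. -/
structure IsOptimal (T : Str → Str →. Str) : Prop where
  interpreter : IsInterpreter T
  optimal : ∀ A : Str → Str →. Str, IsInterpreter A →
    ∃ c : ℕ, ∀ x y : Str, condComplexity T x y ≤ condComplexity A x y + c

/-- `H (x) = H (x | Λ)` for the interpreter `T`, as an extended real number
(it is finite if `T` is optimal). -/
noncomputable def H (T : Str → Str →. Str) (x : Str) : EReal :=
  ((condComplexity T x [] : ℝ≥0∞) : EReal)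

/-- `H (n)` for a natural number `n`, identified with its binary expansion. -/
noncomputable def HNat (T : Str → Str →. Str) (n : ℕ) : EReal :=
  H T (Nat.bits n)

/-- Base-two logarithm on `[0, ∞]`, with values in `[-∞, ∞]`. -/
noncomputable def log2 (a : ℝ≥0∞) : EReal :=
  ENNReal.log a / ((Real.log 2 : ℝ) : EReal)

/-! ### Constructive topology -/

/-- `G` is r.e. open with respect to the enumerated subbase `ν`: it is the union of a recursively
enumerable family of finite intersections of elements of the subbase. -/
def REOpen {X ι : Type} [Primcodable ι] (ν : ι → Set X) (G : Set X) : Prop :=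
  ∃ E : List ι → Prop, REPred E ∧ G = {x | ∃ w : List ι, E w ∧ ∀ i ∈ w, x ∈ ν i}

/-- The enumerated subbase of the product of two constructive topological spaces. -/
def prodSubbase {X Y ι κ : Type} (ν : ι → Set X) (ξ : κ → Set Y) : ι ⊕ κ → Set (X × Y)
  | Sum.inl i => {z | z.1 ∈ ν i}
  | Sum.inr k => {z | z.2 ∈ ξ k}

/-- The enumerated subbase of singletons of a discrete space. -/
def discreteSubbase (X : Type) : X → Set X := fun x => {x}

/-- The (surjective) notation `(a, b) ↦ a / (b + 1)` of the rational numbers. -/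
def ratOf (q : ℤ × ℕ) : ℚ := (q.1 : ℚ) / ((q.2 : ℚ) + 1)

/-- The enumerated subbase of singletons of the discrete space of rational numbers. -/
def ratSubbase : ℤ × ℕ → Set ℚ := fun q => {ratOf q}

/-- `f : X → [0, ∞]` is lower semicomputable if `{(x, r) : f (x) > r}` (`r` rational)
is r.e. open. -/
def LowerSemicomputable {X ι : Type} [Primcodable ι] (ν : ι → Set X) (f : X → ℝ≥0∞) : Prop :=
  REOpen (prodSubbase ν ratSubbase)
    {z : X × ℚ | (((z.2 : ℚ) : ℝ) : EReal) < ((f z.1 : ℝ≥0∞) : EReal)}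

/-! ### The space of probability measures over the discrete space of binary strings

A probability measure over the (countable, discrete) space of strings is a `PMF Str`. -/

/-- The metric of the discrete space of strings. -/
def dist01 (x y : Str) : ℝ := if x = y then 0 else 1

/-- The function `g_{u, r, ε} (x) = |1 - |d (x, u) - r|⁺ / ε|⁺` with `ε = 1 / (n + 1)`, where
`(u, r, n)` is the given index. -/
noncomputable def bump (i : Str × (ℤ × ℕ) × ℕ) (x : Str) : ℝ :=
  max (1 - max (dist01 x i.1 - (ratOf i.2.1 : ℝ)) 0 / (1 / ((i.2.2 : ℝ) + 1))) 0

/-- Minimum of finitely many of the functions `bump i` (all of them are at most `1`, and the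
constant `1` is one of them). -/
noncomputable def minBump (l : List (Str × (ℤ × ℕ) × ℕ)) (x : Str) : ℝ :=
  l.foldr (fun i m => min (bump i x) m) 1

/-- `μ f`, for a bounded function `f` on the strings. -/
noncomputable def expect (μ : PMF Str) (f : Str → ℝ) : ℝ := ∑' x, (μ x).toReal * f x

/-- Indices of the subbase of the weak topology. -/
abbrev MeasIdx : Type := Bool × List (Str × (ℤ × ℕ) × ℕ) × (ℤ × ℕ)

/-- The enumerated subbase of the weak topology on the space of probability measures: the sets
`{μ : μ f < r}` and `{μ : μ f > r}`, where `f` is a minimum of finitely many bump functions and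
`r` is rational. -/
def measSubbase : MeasIdx → Set (PMF Str)
  | (false, l, q) => {μ | expect μ (minBump l) < ((ratOf q : ℚ) : ℝ)}
  | (true, l, q) => {μ | ((ratOf q : ℚ) : ℝ) < expect μ (minBump l)}

/-- A computable measure: a computable element of the space of measures, that is, the set of
the subbase elements containing it is recursively enumerable. -/
def IsComputableMeasure (μ : PMF Str) : Prop := REPred fun i : MeasIdx => μ ∈ measSubbase i

/-! ### Uniform randomness tests -/

/-- A uniform randomness test over the discrete space of binary strings. -/
structure IsTest (f : PMF Str → Str → ℝ≥0∞) : Prop where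
  lsc : LowerSemicomputable (prodSubbase measSubbase (discreteSubbase Str))
    (fun z : PMF Str × Str => f z.1 z.2)
  integral_le : ∀ μ : PMF Str, ∑' x, μ x * f μ x ≤ 1

/-- A universal uniform test: one that dominates every other test up to a constant factor. -/
structure IsUniversalTest (t : PMF Str → Str → ℝ≥0∞) : Prop where
  test : IsTest t
  universal : ∀ f : PMF Str → Str → ℝ≥0∞, IsTest f →
    ∃ c : ℝ≥0, 0 < c ∧ ∀ (μ : PMF Str) (x : Str), (c : ℝ≥0∞) * f μ x ≤ t μ x

/-- The deficiency of randomness `d_μ (x) = log t_μ (x)`. -/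
noncomputable def deficiency (t : PMF Str → Str → ℝ≥0∞) (μ : PMF Str) (x : Str) : EReal :=
  log2 (t μ x)

/-- The expression `- log μ (x) - H (x)`. -/
noncomputable def complexityFormula (T : Str → Str →. Str) (μ : PMF Str) (x : Str) : EReal :=
  - log2 (μ x) - H T x

end UniformTest

/-!
The measure is concentrated on a single branch of the binary tree: if `s n` denotes the suffix of
length `n` of a left-infinite binary string, then `μ (s n) = 2 ^ (-n - 1)`. Strings grow to the
left only because lists do.

*The branch.* Summing the a priori probabilities of all (countably many) interpreters with weights
`2 ^ (-i - 1)` gives, by the Kraft inequality, a function `m` with `∑ x, m x ≤ 1`. Always passing to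
the child whose subtree has the smaller `m`-mass yields a branch with `m (s n) ≤ 2 ^ (-n)`, so that
`H (s n) ≥ n - O(1)` for every interpreter (`exists_incompressible_branch`). This bounds
`-log μ (s n) - H (s n)` from above. It also makes `μ` non-computable: from a computable `μ` one
could compute `s (2 * k)` from the unary code of `k`
(`not_isComputableMeasure_branchMeasure`).

*The deficiency along the branch.* Put `D n = d_μ (s n)`. The measure `μ` almost reveals its own
branch: if the proper suffixes of some `x` of length `n` have nearly the `μ`-masses above, then only
`O (2 ^ (-n))` is left for all strings of length `n`, and a test may take the value `n + 1` at `x`.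
Hence `D` is unbounded (`IsUniversalTest.length_le`). On the other hand, for a universal `t` the
function `(ν, x) ↦ t ν (b :: x)`, restricted by explicit bounds that force `ν x ≤ 8 * ν (b :: x)`, is
again a test up to a constant factor, so `D (n + 1) ≤ D n + O(1)` (`IsUniversalTest.shift_le`).

*Conclusion.* An unbounded sequence with bounded increments comes within a constant of every real
number that is not far below its first term (`exists_near`). The numbers `n - H n` are bounded below,
because the unary code gives `H n ≤ n + O(1)`; so each of them is `D k` up to a constant for some `k`,
and `x = s k` is as required. There is no need to know that `D n` itself is close to `n - H n`.

To handle lower semicomputable functions of measures, the enumeration of the basic open sets in the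
graph is brought into a normal form (`Enumerates`) in which the string and the rational number are
explicit arguments and only the conditions on the measure remain as subbase elements.
-/

namespace UniformTest

/-! ### Recursively enumerable predicates -/

section RecursivelyEnumerable

variable {α β : Type} [Primcodable α] [Primcodable β]

/-- Uniformization: an r.e. relation contains the graph of a partial computable function with
the same projection. -/
theorem exists_partrec_of_rePred {p : α × β → Prop} (hp : REPred p) :
    ∃ f : α →. β, Partrec f ∧ (∀ a, ∀ b ∈ f a, p (a, b)) ∧
      ∀ a, (∃ b, p (a, b)) → (f a).Dom := by
  obtain ⟨c, hc⟩ := Nat.Partrec.Code.exists_code.1 hp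
  have hmem : ∀ z : α × β, p z ↔ ∃ k, (c.evaln k (Encodable.encode z)).isSome := by
    intro z
    have h1 : (c.eval (Encodable.encode z)).Dom ↔ p z := by
      rw [hc]; simp [Part.dom_iff_mem]
    rw [← h1, Part.dom_iff_mem]
    simp only [Nat.Partrec.Code.evaln_complete, Option.isSome_iff_exists, Option.mem_def]
    exact exists_comm
  -- `n` codes a candidate `b` together with a bound on the running time of the test of `p (a, b)`.
  let g : α → ℕ → Option β := fun a n =>
    (Encodable.decode (α := β) n.unpair.1).bind fun b =>
      (c.evaln n.unpair.2 (Encodable.encode (a, b))).map fun _ => b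
  have hg : Primrec₂ g := by
    refine Primrec.option_bind
      (Primrec.decode.comp (Primrec.fst.comp (Primrec.unpair.comp Primrec.snd))) ?_
    refine Primrec.option_map ?_ (Primrec.snd.comp Primrec.fst).to₂
    exact Nat.Partrec.Code.primrec_evaln.comp (Primrec.pair (Primrec.pair
      (Primrec.snd.comp (Primrec.unpair.comp (Primrec.snd.comp Primrec.fst))) (Primrec.const c))
      (Primrec.encode.comp (Primrec.pair (Primrec.fst.comp Primrec.fst) Primrec.snd)))
  have hgmem : ∀ a n b, b ∈ g a n → p (a, b) := by
    intro a n b h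
    simp only [g, Option.mem_def, Option.bind_eq_some_iff, Option.map_eq_some_iff] at h
    obtain ⟨b', -, m, hm, rfl⟩ := h
    exact (hmem _).2 ⟨_, by rw [hm]; rfl⟩
  refine ⟨fun a => Nat.rfindOpt (g a), Partrec.rfindOpt hg.to_comp, ?_, ?_⟩
  · intro a b h
    obtain ⟨n, hn⟩ := Nat.rfindOpt_spec h
    exact hgmem a n b hn
  · rintro a ⟨b, hb⟩
    obtain ⟨k, hk⟩ := (hmem _).1 hb
    obtain ⟨m, hm⟩ := Option.isSome_iff_exists.1 hk
    exact Nat.rfindOpt_dom.2 ⟨Nat.pair (Encodable.encode b) k, b, by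
      simp only [g, Nat.unpair_pair, Encodable.encodek, Option.bind_some, hm, Option.map_some]; rfl⟩

theorem rePred_exists {p : α × β → Prop} (hp : REPred p) : REPred fun a => ∃ b, p (a, b) := by
  obtain ⟨f, hf, h1, h2⟩ := exists_partrec_of_rePred hp
  refine hf.dom_re.of_eq fun a => ⟨fun h => ?_, h2 a⟩
  exact ⟨(f a).get h, h1 a _ (Part.get_mem h)⟩

theorem rePred_comp {p : β → Prop} (hp : REPred p) {f : α → β} (hf : Computable f) :
    REPred fun a => p (f a) :=
  Partrec.comp hp hf

theorem rePred_of_primrecPred {p : α → Prop} (hp : PrimrecPred p) : REPred p :=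
  hp.computablePred.to_re

theorem rePred_and {p q : α → Prop} (hp : REPred p) (hq : REPred q) :
    REPred fun a => p a ∧ q a := by
  have h : Partrec fun a => (Part.assert (p a) fun _ => Part.some ()).bind
      fun _ => Part.assert (q a) fun _ => Part.some () :=
    Partrec.bind hp (Partrec.comp hq Computable.fst).to₂
  exact h.dom_re.of_eq fun a => by simp [Part.dom_iff_mem]

theorem rePred_or {p q : α → Prop} (hp : REPred p) (hq : REPred q) :
    REPred fun a => p a ∨ q a := by
  obtain ⟨k, hk, H⟩ := Partrec.merge' hp hq
  exact hk.dom_re.of_eq fun a => by rw [(H a).2]; simp [Part.dom_iff_mem]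

end RecursivelyEnumerable

/-! ### Computability of the notation of rational numbers -/

theorem encode_int_natCast (n : ℕ) : Encodable.encode (n : ℤ) = 2 * n := rfl

theorem encode_int_negSucc (n : ℕ) : Encodable.encode (Int.negSucc n) = 2 * n + 1 := rfl

theorem primrec_int_natCast : Primrec (Nat.cast : ℕ → ℤ) :=
  Primrec.encode_iff.1 (Primrec.nat_mul.comp (Primrec.const 2) Primrec.id)

theorem primrec_int_natAbs : Primrec Int.natAbs := by
  refine (Primrec.nat_div.comp (Primrec.succ.comp (Primrec.encode (α := ℤ)))
    (Primrec.const 2)).of_eq fun z => ?_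
  cases z with
  | ofNat n => have := encode_int_natCast n; simp only [Int.ofNat_eq_natCast, this]; simp; omega
  | negSucc n => rw [encode_int_negSucc]; simp; omega

theorem primrecPred_int_neg : PrimrecPred fun z : ℤ => z < 0 := by
  refine (PrimrecRel.comp Primrec.eq (Primrec.nat_mod.comp (Primrec.encode (α := ℤ))
    (Primrec.const 2)) (Primrec.const 1)).of_eq fun z => ?_
  cases z with
  | ofNat n => have := encode_int_natCast n; simp only [Int.ofNat_eq_natCast, this]; simp
  | negSucc n => rw [encode_int_negSucc]; simp [Int.negSucc_lt_zero, Nat.add_mod]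

theorem ratOf_neg_iff (q : ℤ × ℕ) : ratOf q < 0 ↔ q.1 < 0 := by
  have h : (0 : ℚ) < (q.2 : ℚ) + 1 := by positivity
  unfold ratOf
  rw [div_lt_iff₀ h, zero_mul]
  exact_mod_cast Iff.rfl

/-- Signs and absolute values are used instead of multiplication in `ℤ`, so that only arithmetic in
`ℕ` has to be shown primitive recursive. -/
theorem ratOf_eq_mul_iff (K : ℕ) (hK : 0 < K) (q r : ℤ × ℕ) :
    ratOf q = K * ratOf r ↔
      (q.1 < 0 ↔ r.1 < 0) ∧ q.1.natAbs * (r.2 + 1) = K * (r.1.natAbs * (q.2 + 1)) := by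
  obtain ⟨a, b⟩ := q
  obtain ⟨a', b'⟩ := r
  have h1 : ratOf (a, b) = K * ratOf (a', b') ↔ a * (b' + 1) = K * (a' * (b + 1)) := by
    unfold ratOf
    have hb : ((b : ℚ) + 1) ≠ 0 := by positivity
    have hb' : ((b' : ℚ) + 1) ≠ 0 := by positivity
    rw [← mul_div_assoc, div_eq_div_iff hb hb', mul_assoc]
    exact_mod_cast Iff.rfl
  rw [h1]
  have hK' : (0 : ℤ) < K := by exact_mod_cast hK
  have hb : (0 : ℤ) < (b : ℤ) + 1 := by positivity
  have hb' : (0 : ℤ) < (b' : ℤ) + 1 := by positivity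
  have hs1 : a < 0 ↔ a * (b' + 1) < 0 := by
    rw [mul_neg_iff]; constructor
    · intro h; exact Or.inr ⟨h, hb'⟩
    · rintro (h | h); exacts [absurd hb' (by omega), h.1]
  have hs2 : a' < 0 ↔ K * (a' * (b + 1)) < 0 := by
    rw [mul_neg_iff, mul_neg_iff]; constructor
    · intro h; exact Or.inl ⟨hK', Or.inr ⟨h, hb⟩⟩
    · rintro (⟨-, h | h⟩ | h)
      exacts [absurd hb (by omega), h.1, absurd hK' (by omega)]
  have hn1 : a.natAbs * (b' + 1) = (a * (b' + 1)).natAbs := by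
    rw [Int.natAbs_mul]; norm_cast
  have hn2 : K * (a'.natAbs * (b + 1)) = (K * (a' * (b + 1))).natAbs := by
    rw [Int.natAbs_mul, Int.natAbs_mul]; norm_cast
  dsimp only
  rw [hs1, hs2, hn1, hn2]
  omega

theorem primrecPred_iff {α : Type} [Primcodable α] {p q : α → Prop} (hp : PrimrecPred p)
    (hq : PrimrecPred q) : PrimrecPred fun a => p a ↔ q a :=
  ((hp.and hq).or (hp.not.and hq.not)).of_eq fun a => by tauto

theorem primrecPred_ratOf_eq_mul (K : ℕ) (hK : 0 < K) :
    PrimrecRel fun q r : ℤ × ℕ => ratOf q = K * ratOf r := by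
  have h1 : PrimrecPred fun z : (ℤ × ℕ) × ℤ × ℕ => z.1.1 < 0 ↔ z.2.1 < 0 :=
    primrecPred_iff (primrecPred_int_neg.comp (Primrec.fst.comp Primrec.fst))
      (primrecPred_int_neg.comp (Primrec.fst.comp Primrec.snd))
  have h2 : PrimrecPred fun z : (ℤ × ℕ) × ℤ × ℕ =>
      z.1.1.natAbs * (z.2.2 + 1) = K * (z.2.1.natAbs * (z.1.2 + 1)) := by
    refine Primrec.eq.comp (Primrec.nat_mul.comp ?_ ?_) (Primrec.nat_mul.comp (Primrec.const K)
      (Primrec.nat_mul.comp ?_ ?_))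
    · exact primrec_int_natAbs.comp (Primrec.fst.comp Primrec.fst)
    · exact Primrec.succ.comp (Primrec.snd.comp Primrec.snd)
    · exact primrec_int_natAbs.comp (Primrec.fst.comp Primrec.snd)
    · exact Primrec.succ.comp (Primrec.snd.comp Primrec.fst)
  exact (h1.and h2).of_eq fun z => (ratOf_eq_mul_iff K hK z.1 z.2).symm

theorem primrecPred_ratOf_neg : PrimrecPred fun q : ℤ × ℕ => ratOf q < 0 :=
  (primrecPred_int_neg.comp Primrec.fst).of_eq fun q => (ratOf_neg_iff q).symm

theorem ratOf_lt_natCast_succ_iff (q : ℤ × ℕ) (n : ℕ) :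
    ratOf q < ((n + 1 : ℕ) : ℚ) ↔ q.1 < 0 ∨ q.1.natAbs < (n + 1) * (q.2 + 1) := by
  obtain ⟨a, b⟩ := q
  have h : (0 : ℚ) < (b : ℚ) + 1 := by positivity
  have h1 : ratOf (a, b) < ((n + 1 : ℕ) : ℚ) ↔ a < (((n + 1) * (b + 1) : ℕ) : ℤ) := by
    unfold ratOf
    rw [div_lt_iff₀ h]
    exact_mod_cast Iff.rfl
  rw [h1]
  dsimp only
  generalize (n + 1) * (b + 1) = m
  omega

theorem primrecPred_ratOf_lt_natCast_succ :
    PrimrecRel fun (q : ℤ × ℕ) (n : ℕ) => ratOf q < ((n + 1 : ℕ) : ℚ) := by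
  have h2 : PrimrecPred fun z : (ℤ × ℕ) × ℕ => z.1.1.natAbs < (z.2 + 1) * (z.1.2 + 1) :=
    Primrec.nat_lt.comp (primrec_int_natAbs.comp (Primrec.fst.comp Primrec.fst))
      (Primrec.nat_mul.comp (Primrec.succ.comp Primrec.snd)
        (Primrec.succ.comp (Primrec.snd.comp Primrec.fst)))
  exact ((primrecPred_int_neg.comp (Primrec.fst.comp Primrec.fst)).or h2).of_eq
    fun z => (ratOf_lt_natCast_succ_iff z.1 z.2).symm

theorem exists_ratOf_eq (r : ℚ) : ∃ q, ratOf q = r := by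
  refine ⟨(r.num, r.den - 1), ?_⟩
  have h : ((r.den - 1 : ℕ) : ℚ) + 1 = r.den := by
    have := r.den_pos
    exact_mod_cast Nat.sub_add_cancel this
  simp [ratOf, h, Rat.num_div_den]

theorem primrec_two_pow : Primrec fun n : ℕ => 2 ^ n :=
  (Primrec.nat_rec₁ 1 (Primrec.nat_mul.comp (Primrec.const 2) Primrec.snd).to₂).of_eq fun n => by
    induction n with
    | zero => rfl
    | succ n ih => rw [pow_succ', ← ih]

/-! ### Lower semicomputable functions of a measure and a string -/

/-- Indices of the subbase of the product of the space of measures, the space of strings and the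
space of rational numbers. -/
abbrev GraphIdx : Type := (MeasIdx ⊕ Str) ⊕ (ℤ × ℕ)

/-- The relation `R` between lists of subbase elements of the space of measures, strings and
rational indices enumerates the graph of `f` from below: it lists basic open sets of measures on
which `f (·, x)` exceeds a given rational number. -/
def Enumerates (R : List MeasIdx × Str × (ℤ × ℕ) → Prop) (f : PMF Str → Str → ℝ≥0∞) : Prop :=
  REPred R ∧ ∀ ν x q, (((ratOf q : ℚ) : ℝ) : EReal) < ((f ν x : ℝ≥0∞) : EReal) ↔
    ∃ w, R (w, x, q) ∧ ∀ i ∈ w, ν ∈ measSubbase i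

/-- The measure index carried by an index of the product space, if any. -/
def measOf? (i : GraphIdx) : Option MeasIdx :=
  Sum.casesOn i (fun j => Sum.casesOn j some fun _ => none) fun _ => none

/-- The string that an index of the product space forces, with default value `x`. -/
def strOfD (i : GraphIdx) (x : Str) : Str :=
  Sum.casesOn i (fun j => Sum.casesOn j (fun _ => x) id) fun _ => x

/-- The rational index that an index of the product space forces, with default value `q`. -/
def ratOfD (i : GraphIdx) (q : ℤ × ℕ) : ℤ × ℕ :=
  Sum.casesOn i (fun _ => q) id

theorem primrec_measOf? : Primrec measOf? :=
  Primrec.sumCasesOn Primrec.id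
    (Primrec.sumCasesOn Primrec.snd (Primrec.option_some.comp Primrec.snd).to₂
      (Primrec.const none).to₂).to₂
    (Primrec.const none).to₂

theorem primrec_strOfD : Primrec₂ strOfD :=
  Primrec.sumCasesOn Primrec.fst
    (Primrec.sumCasesOn Primrec.snd (Primrec.snd.comp (Primrec.fst.comp Primrec.fst)).to₂
      Primrec.snd.to₂).to₂
    (Primrec.snd.comp Primrec.fst).to₂

theorem primrec_ratOfD : Primrec₂ ratOfD :=
  Primrec.sumCasesOn Primrec.fst (Primrec.snd.comp Primrec.fst).to₂ Primrec.snd.to₂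

theorem mem_prodSubbase_iff (i : GraphIdx) (ν : PMF Str) (x : Str) (q : ℤ × ℕ) :
    ((ν, x), ratOf q) ∈ prodSubbase (prodSubbase measSubbase (discreteSubbase Str)) ratSubbase i ↔
      strOfD i x = x ∧ ratOf (ratOfD i q) = ratOf q ∧ ∀ j ∈ measOf? i, ν ∈ measSubbase j := by
  rcases i with (j | y) | p
  · simp [prodSubbase, strOfD, ratOfD, measOf?]
  · simp [prodSubbase, strOfD, ratOfD, measOf?, discreteSubbase, eq_comm]
  · simp [prodSubbase, strOfD, ratOfD, measOf?, ratSubbase, eq_comm]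

/-- The singletons of strings and rational numbers in an enumeration of the graph of a lower
semicomputable function can be replaced by explicit arguments. -/
theorem exists_enumerates {f : PMF Str → Str → ℝ≥0∞}
    (hf : LowerSemicomputable (prodSubbase measSubbase (discreteSubbase Str))
      (fun z : PMF Str × Str => f z.1 z.2)) : ∃ R, Enumerates R f := by
  obtain ⟨E, hE, hEf⟩ := hf
  -- Equality of the rationals is written with the factor `1` to use `primrecPred_ratOf_eq_mul`.
  refine ⟨fun z => ∃ W : List GraphIdx, E W ∧
    (∀ i ∈ W, strOfD i z.2.1 = z.2.1 ∧ ratOf (ratOfD i z.2.2) = ((1 : ℕ) : ℚ) * ratOf z.2.2) ∧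
      W.filterMap measOf? = z.1, ?_, ?_⟩
  · have h1 : REPred fun a : (List MeasIdx × Str × (ℤ × ℕ)) × List GraphIdx => E a.2 :=
      rePred_comp hE Computable.snd
    have h2 : PrimrecRel fun (i : GraphIdx) (a : List MeasIdx × Str × (ℤ × ℕ)) =>
        strOfD i a.2.1 = a.2.1 ∧ ratOf (ratOfD i a.2.2) = ((1 : ℕ) : ℚ) * ratOf a.2.2 := by
      have hx : Primrec fun z : GraphIdx × List MeasIdx × Str × (ℤ × ℕ) => z.2.2.1 :=
        Primrec.fst.comp (Primrec.snd.comp Primrec.snd)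
      have hq : Primrec fun z : GraphIdx × List MeasIdx × Str × (ℤ × ℕ) => z.2.2.2 :=
        Primrec.snd.comp (Primrec.snd.comp Primrec.snd)
      exact (Primrec.eq.comp (primrec_strOfD.comp Primrec.fst hx) hx).and
        ((primrecPred_ratOf_eq_mul 1 one_pos).comp (primrec_ratOfD.comp Primrec.fst hq) hq)
    have h3 : PrimrecPred fun a : (List MeasIdx × Str × (ℤ × ℕ)) × List GraphIdx =>
        ∀ i ∈ a.2, strOfD i a.1.2.1 = a.1.2.1 ∧
          ratOf (ratOfD i a.1.2.2) = ((1 : ℕ) : ℚ) * ratOf a.1.2.2 :=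
      h2.forall_mem_list.comp Primrec.snd Primrec.fst
    have h4 : PrimrecPred fun a : (List MeasIdx × Str × (ℤ × ℕ)) × List GraphIdx =>
        a.2.filterMap measOf? = a.1.1 :=
      Primrec.eq.comp (Primrec.listFilterMap Primrec.snd (primrec_measOf?.comp Primrec.snd).to₂)
        (Primrec.fst.comp Primrec.fst)
    exact rePred_exists (rePred_and h1 (rePred_of_primrecPred (h3.and h4)))
  · intro ν x q
    have h := Set.ext_iff.1 hEf ((ν, x), ratOf q)
    simp only [Set.mem_ofPred_eq] at h
    rw [h]
    constructor
    · rintro ⟨W, hW, hall⟩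
      refine ⟨W.filterMap measOf?, ⟨W, hW, fun i hi => ?_, rfl⟩, fun j hj => ?_⟩
      · obtain ⟨h1, h2, -⟩ := (mem_prodSubbase_iff i ν x q).1 (hall i hi)
        exact ⟨h1, by rw [h2]; simp⟩
      · obtain ⟨i, hi, hij⟩ := List.mem_filterMap.1 hj
        exact ((mem_prodSubbase_iff i ν x q).1 (hall i hi)).2.2 j hij
    · rintro ⟨_, ⟨W, hW, hc, rfl⟩, hall⟩
      refine ⟨W, hW, fun i hi => (mem_prodSubbase_iff i ν x q).2 ⟨(hc i hi).1, ?_, ?_⟩⟩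
      · simpa using (hc i hi).2
      · exact fun j hj => hall j (List.mem_filterMap.2 ⟨i, hi, hj⟩)

theorem Enumerates.lowerSemicomputable {R : List MeasIdx × Str × (ℤ × ℕ) → Prop}
    {f : PMF Str → Str → ℝ≥0∞} (h : Enumerates R f) :
    LowerSemicomputable (prodSubbase measSubbase (discreteSubbase Str))
      (fun z : PMF Str × Str => f z.1 z.2) := by
  obtain ⟨hR, hf⟩ := h
  let g : List MeasIdx × Str × (ℤ × ℕ) → List GraphIdx := fun a =>
    Sum.inl (Sum.inr a.2.1) :: Sum.inr a.2.2 :: a.1.map fun i => Sum.inl (Sum.inl i)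
  have hg : Primrec g := by
    refine Primrec.list_cons.comp (Primrec.sumInl.comp (Primrec.sumInr.comp
      (Primrec.fst.comp Primrec.snd))) (Primrec.list_cons.comp (Primrec.sumInr.comp
      (Primrec.snd.comp Primrec.snd)) (Primrec.list_map Primrec.fst ?_))
    exact (Primrec.sumInl.comp (Primrec.sumInl.comp Primrec.snd)).to₂
  refine ⟨fun W => ∃ a, R a ∧ g a = W, ?_, ?_⟩
  · exact rePred_exists (rePred_and (rePred_comp hR Computable.snd) (rePred_of_primrecPred
      (Primrec.eq.comp (hg.comp Primrec.snd) Primrec.fst)))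
  · ext ⟨⟨ν, x⟩, r⟩
    obtain ⟨q, rfl⟩ := exists_ratOf_eq r
    simp only [Set.mem_ofPred_eq]
    rw [hf ν x q]
    constructor
    · rintro ⟨w, hw, hall⟩
      refine ⟨_, ⟨_, hw, rfl⟩, fun i hi => ?_⟩
      simp only [g, List.mem_cons, List.mem_map] at hi
      rcases hi with rfl | rfl | ⟨j, hj, rfl⟩
      · simp [prodSubbase, discreteSubbase]
      · simp [prodSubbase, ratSubbase]
      · exact hall j hj
    · rintro ⟨_, ⟨⟨w, y, p⟩, hw, rfl⟩, hall⟩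
      have hy : x = y := hall (Sum.inl (Sum.inr y)) (by simp [g])
      have hp : ratOf q = ratOf p := hall (Sum.inr p) (by simp [g])
      have hν : ∀ i ∈ w, ν ∈ measSubbase i := fun i hi =>
        hall (Sum.inl (Sum.inl i)) (by simp [g, hi])
      subst hy
      have := (hf ν x p).2 ⟨w, hw, hν⟩
      rw [← hp] at this
      exact (hf ν x q).1 this

theorem coe_lt_coe_ennreal_iff (r : ℝ) (a : ℝ≥0∞) :
    (r : EReal) < (a : EReal) ↔ r < 0 ∨ ENNReal.ofReal r < a := by
  rcases lt_or_ge r 0 with h | h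
  · simp only [h, true_or, iff_true]
    exact lt_of_lt_of_le (EReal.coe_lt_coe_iff.2 h) (EReal.coe_ennreal_nonneg a)
  · have h1 : (r : EReal) = ((ENNReal.ofReal r : ℝ≥0∞) : EReal) := by
      rw [EReal.coe_ennreal_ofReal, max_eq_left h]
    rw [h1, EReal.coe_ennreal_lt_coe_ennreal_iff]
    simp [not_lt.2 h]

/-- Dividing a function by `K` amounts to multiplying the rational argument by `K`. -/
theorem Enumerates.div {R : List MeasIdx × Str × (ℤ × ℕ) → Prop}
    {f : PMF Str → Str → ℝ≥0∞} (h : Enumerates R f) (K : ℕ) (hK : 0 < K) :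
    ∃ R', Enumerates R' fun ν x => f ν x / K := by
  obtain ⟨hR, hf⟩ := h
  refine ⟨fun a => ∃ p : ℤ × ℕ, R (a.1, a.2.1, p) ∧ ratOf p = K * ratOf a.2.2, ?_, ?_⟩
  · have h1 : Primrec fun z : (List MeasIdx × Str × (ℤ × ℕ)) × ℤ × ℕ => (z.1.1, z.1.2.1, z.2) :=
      Primrec.pair (Primrec.fst.comp Primrec.fst) (Primrec.pair
        (Primrec.fst.comp (Primrec.snd.comp Primrec.fst)) Primrec.snd)
    exact rePred_exists (rePred_and (rePred_comp hR h1.to_comp)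
      (rePred_of_primrecPred ((primrecPred_ratOf_eq_mul K hK).comp Primrec.snd
        (Primrec.snd.comp (Primrec.snd.comp Primrec.fst)))))
  · intro ν x q
    have hK' : (0 : ℝ) < K := by exact_mod_cast hK
    have key : ((((K : ℚ) * ratOf q : ℚ) : ℝ) : EReal) < (f ν x : EReal) ↔
        (((ratOf q : ℚ) : ℝ) : EReal) < ((f ν x / K : ℝ≥0∞) : EReal) := by
      rw [coe_lt_coe_ennreal_iff, coe_lt_coe_ennreal_iff, ENNReal.lt_div_iff_mul_lt
        (Or.inl (by exact_mod_cast hK.ne')) (Or.inl (ENNReal.natCast_ne_top K))]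
      push_cast
      rw [mul_comm (K : ℝ), ENNReal.ofReal_mul' hK'.le, ENNReal.ofReal_natCast]
      refine or_congr ?_ Iff.rfl
      rw [mul_neg_iff]
      constructor
      · rintro (h | h)
        exacts [absurd h.2 (not_lt.2 hK'.le), h.1]
      · exact fun h => Or.inr ⟨h, hK'⟩
    rw [← key]
    obtain ⟨p, hp⟩ := exists_ratOf_eq ((K : ℚ) * ratOf q)
    constructor
    · intro h
      rw [← hp, hf] at h
      obtain ⟨w, hw, hν⟩ := h
      exact ⟨w, ⟨p, hw, hp⟩, hν⟩
    · rintro ⟨w, ⟨p', hw, hp'⟩, hν⟩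
      dsimp only at hp'
      rw [← hp', hf]
      exact ⟨w, hw, hν⟩

/-- A universal test dominates every lower semicomputable function whose integrals are uniformly
bounded, not only those with integrals at most one. -/
theorem IsUniversalTest.dominates {t f : PMF Str → Str → ℝ≥0∞} (ht : IsUniversalTest t)
    {R : List MeasIdx × Str × (ℤ × ℕ) → Prop} (hf : Enumerates R f) (K : ℕ) (hK : 0 < K)
    (hle : ∀ ν : PMF Str, ∑' x, ν x * f ν x ≤ K) :
    ∃ c : ℝ≥0, 0 < c ∧ ∀ (ν : PMF Str) (x : Str), (c : ℝ≥0∞) * f ν x ≤ t ν x := by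
  obtain ⟨R', hR'⟩ := hf.div K hK
  have htest : IsTest fun ν x => f ν x / K := by
    refine ⟨hR'.lowerSemicomputable, fun ν => ?_⟩
    simp only [div_eq_mul_inv, ← mul_assoc]
    rw [ENNReal.tsum_mul_right, ← div_eq_mul_inv]
    exact ENNReal.div_le_of_le_mul (by simpa using hle ν)
  obtain ⟨c, hc, h⟩ := ht.universal _ htest
  refine ⟨c / K, by positivity, fun ν x => ?_⟩
  refine le_trans (le_of_eq ?_) (h ν x)
  rw [ENNReal.coe_div (by exact_mod_cast hK.ne'), div_eq_mul_inv, div_eq_mul_inv]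
  simp only [ENNReal.coe_natCast]
  ring

/-! ### Conditions on point masses -/

/-- The index of the condition `ν y < q` (for `b = false`) or `q < ν y` (for `b = true`): the bump
function with `r = 0` and `ε = 1` is the indicator of `y`. -/
def pointIdx (b : Bool) (y : Str) (q : ℤ × ℕ) : MeasIdx := (b, [(y, (0, 0), 0)], q)

theorem expect_point (ν : PMF Str) (y : Str) :
    expect ν (minBump [(y, (0, 0), 0)]) = (ν y).toReal := by
  have h : ∀ x, minBump [(y, (0, 0), 0)] x = if x = y then 1 else 0 := by
    intro x
    by_cases hx : x = y <;> simp [minBump, bump, dist01, ratOf, hx]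
  unfold expect
  rw [tsum_eq_single y]
  · simp [h]
  · intro x hx; simp [h, hx]

theorem mem_pointIdx_false (ν : PMF Str) (y : Str) (q : ℤ × ℕ) :
    ν ∈ measSubbase (pointIdx false y q) ↔ (ν y).toReal < ((ratOf q : ℚ) : ℝ) := by
  rw [← expect_point]; exact Iff.rfl

theorem mem_pointIdx_true (ν : PMF Str) (y : Str) (q : ℤ × ℕ) :
    ν ∈ measSubbase (pointIdx true y q) ↔ ((ratOf q : ℚ) : ℝ) < (ν y).toReal := by
  rw [← expect_point]; exact Iff.rfl

theorem primrec_pointIdx {α : Type} [Primcodable α] (b : Bool) {y : α → Str} {q : α → ℤ × ℕ}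
    (hy : Primrec y) (hq : Primrec q) : Primrec fun a => pointIdx b (y a) (q a) :=
  Primrec.pair (Primrec.const b) (Primrec.pair (Primrec.list_cons.comp
    (Primrec.pair hy (Primrec.const ((0, 0), 0))) (Primrec.const [])) hq)

/-- The index of the dyadic rational `2 ^ (-n)`. -/
def dyadic (n : ℕ) : ℤ × ℕ := (1, 2 ^ n - 1)

theorem ratOf_dyadic (n : ℕ) : ((ratOf (dyadic n) : ℚ) : ℝ) = (2⁻¹ : ℝ) ^ n := by
  simp [ratOf, dyadic]

theorem primrec_dyadic : Primrec dyadic :=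
  Primrec.pair (Primrec.const 1) (Primrec.nat_sub.comp primrec_two_pow (Primrec.const 1))

/-! ### Universal tests along a computable successor map -/

/-- The conditions `ν x < 2 ^ (-|x|)` and `ν (b x) > 2 ^ (-|x| - 3)`. They make `ν x` at most eight
times as large as `ν (b x)`. -/
def shiftIdx (b : Str → Str) (x : Str) : List MeasIdx :=
  [pointIdx false x (dyadic x.length), pointIdx true (b x) (dyadic (x.length + 3))]

/-- The values of `t` at `b x`, pulled back to `x` on the measures that satisfy the conditions
`shiftIdx b x`. -/
noncomputable def shift (b : Str → Str) (t : PMF Str → Str → ℝ≥0∞) (ν : PMF Str) (x : Str) :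
    ℝ≥0∞ :=
  ⨆ (_ : ∀ i ∈ shiftIdx b x, ν ∈ measSubbase i), t ν (b x)

theorem Enumerates.shift {R : List MeasIdx × Str × (ℤ × ℕ) → Prop}
    {t : PMF Str → Str → ℝ≥0∞} (h : Enumerates R t) {b : Str → Str} (hb : Primrec b) :
    ∃ R', Enumerates R' (shift b t) := by
  obtain ⟨hR, ht⟩ := h
  refine ⟨fun z => ratOf z.2.2 < 0 ∨ ∃ w : List MeasIdx,
    R (w, b z.2.1, z.2.2) ∧ shiftIdx b z.2.1 ++ w = z.1, ?_, ?_⟩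
  · have h1 : Primrec fun z : (List MeasIdx × Str × (ℤ × ℕ)) × List MeasIdx =>
        (z.2, b z.1.2.1, z.1.2.2) :=
      Primrec.pair Primrec.snd (Primrec.pair
        (hb.comp (Primrec.fst.comp (Primrec.snd.comp Primrec.fst)))
          (Primrec.snd.comp (Primrec.snd.comp Primrec.fst)))
    have h2 : Primrec (shiftIdx b) :=
      Primrec.list_cons.comp (primrec_pointIdx false Primrec.id (primrec_dyadic.comp
        Primrec.list_length)) (Primrec.list_cons.comp (primrec_pointIdx true hb
          (primrec_dyadic.comp (Primrec.nat_add.comp Primrec.list_length (Primrec.const 3))))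
            (Primrec.const []))
    have h3 : PrimrecPred fun z : (List MeasIdx × Str × (ℤ × ℕ)) × List MeasIdx =>
        shiftIdx b z.1.2.1 ++ z.2 = z.1.1 :=
      Primrec.eq.comp (Primrec.list_append.comp (h2.comp (Primrec.fst.comp
        (Primrec.snd.comp Primrec.fst))) Primrec.snd) (Primrec.fst.comp Primrec.fst)
    exact rePred_or (rePred_of_primrecPred (primrecPred_ratOf_neg.comp
      (Primrec.snd.comp Primrec.snd))) (rePred_exists (rePred_and (rePred_comp hR h1.to_comp)
        (rePred_of_primrecPred h3)))
  · intro ν x q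
    have hneg : ((ratOf q : ℚ) : ℝ) < 0 ↔ ratOf q < 0 := by exact_mod_cast Iff.rfl
    rw [coe_lt_coe_ennreal_iff, hneg, UniformTest.shift, lt_iSup_iff, exists_prop]
    constructor
    · rintro (h | ⟨hν, hlt⟩)
      · exact ⟨[], Or.inl h, by simp⟩
      · obtain ⟨w, hw, hw'⟩ := (ht ν (b x) q).1 ((coe_lt_coe_ennreal_iff _ _).2 (Or.inr hlt))
        refine ⟨shiftIdx b x ++ w, Or.inr ⟨w, hw, rfl⟩, fun i hi => ?_⟩
        exact (List.mem_append.1 hi).elim (hν i) (hw' i)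
    · rintro ⟨w', h | ⟨w, hw, hw'⟩, hν⟩
      · exact Or.inl h
      · dsimp only at hw hw'
        subst hw'
        have := (ht ν (b x) q).2 ⟨w, hw, fun i hi => hν i (List.mem_append_right _ hi)⟩
        rw [coe_lt_coe_ennreal_iff, hneg] at this
        exact this.imp_right fun h => ⟨fun i hi => hν i (List.mem_append_left _ hi), h⟩

theorem forall_mem_shiftIdx_iff (b : Str → Str) (x : Str) (ν : PMF Str) :
    (∀ i ∈ shiftIdx b x, ν ∈ measSubbase i) ↔
      (ν x).toReal < (2⁻¹ : ℝ) ^ x.length ∧ (2⁻¹ : ℝ) ^ (x.length + 3) < (ν (b x)).toReal := by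
  simp [shiftIdx, mem_pointIdx_false, mem_pointIdx_true, ratOf_dyadic]

theorem tsum_mul_shift_le {t : PMF Str → Str → ℝ≥0∞} (ht : IsTest t) {b : Str → Str}
    (hb : Function.Injective b) (ν : PMF Str) : ∑' x, ν x * shift b t ν x ≤ (8 : ℕ) := by
  have h1 : ∀ x, (∀ i ∈ shiftIdx b x, ν ∈ measSubbase i) → ν x ≤ 8 * ν (b x) := by
    intro x hx
    rw [forall_mem_shiftIdx_iff] at hx
    have h2 : (ν x).toReal ≤ 8 * (ν (b x)).toReal := by
      have := hx.2; rw [pow_add] at this; linarith [hx.1]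
    rw [← ENNReal.toReal_le_toReal (ν.apply_ne_top _)
      (ENNReal.mul_ne_top (by simp) (ν.apply_ne_top _))]
    simpa using h2
  calc ∑' x, ν x * shift b t ν x
      ≤ ∑' x, 8 * (ν (b x) * t ν (b x)) := by
        refine ENNReal.tsum_le_tsum fun x => ?_
        unfold shift
        rw [ENNReal.mul_iSup]
        refine iSup_le fun hx => ?_
        rw [← mul_assoc]
        exact mul_le_mul_left (h1 x hx) _
    _ = 8 * ∑' x, ν (b x) * t ν (b x) := ENNReal.tsum_mul_left
    _ ≤ 8 * 1 := by
        refine mul_le_mul_right (le_trans ?_ (ht.integral_le ν)) _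
        exact ENNReal.tsum_comp_le_tsum_of_injective hb fun x => ν x * t ν x
    _ = (8 : ℕ) := by norm_num

/-- A universal test at `x` is at least of the order of its value at a computable successor `b x`
of comparable measure. -/
theorem IsUniversalTest.shift_le {t : PMF Str → Str → ℝ≥0∞} (ht : IsUniversalTest t)
    {b : Str → Str} (hb : Primrec b) (hb' : Function.Injective b) :
    ∃ c : ℝ≥0, 0 < c ∧ ∀ (ν : PMF Str) (x : Str), (ν x).toReal < (2⁻¹ : ℝ) ^ x.length →
      (2⁻¹ : ℝ) ^ (x.length + 3) < (ν (b x)).toReal → (c : ℝ≥0∞) * t ν (b x) ≤ t ν x := by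
  obtain ⟨R, hR⟩ := exists_enumerates ht.test.lsc
  obtain ⟨R', hR'⟩ := hR.shift hb
  obtain ⟨c, hc, h⟩ := ht.dominates hR' 8 (by norm_num) (tsum_mul_shift_le ht.test hb')
  refine ⟨c, hc, fun ν x h1 h2 => le_trans (mul_le_mul_right ?_ _) (h ν x)⟩
  exact le_iSup_of_le ((forall_mem_shiftIdx_iff b x ν).2 ⟨h1, h2⟩) le_rfl

/-! ### A test that recognizes the branch of a measure -/

/-- The conditions `ν y > (1 - 2 ^ (-n)) * 2 ^ (-|y| - 1)` for all proper suffixes `y` of `x`,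
where `n = |x|`. -/
def branchIdx (x : Str) : List MeasIdx :=
  (List.range x.length).map fun j => pointIdx true (x.drop (x.length - j))
    (((2 ^ x.length - 1 : ℕ) : ℤ), 2 ^ (x.length + j + 1) - 1)

theorem primrec_branchIdx : Primrec branchIdx := by
  have hn : Primrec fun z : Str × ℕ => z.1.length := Primrec.list_length.comp Primrec.fst
  have hq : Primrec fun z : Str × ℕ =>
      ((((2 ^ z.1.length - 1 : ℕ) : ℤ), 2 ^ (z.1.length + z.2 + 1) - 1) : ℤ × ℕ) :=
    Primrec.pair
      (primrec_int_natCast.comp (Primrec.nat_sub.comp (primrec_two_pow.comp hn) (Primrec.const 1)))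
      (Primrec.nat_sub.comp (primrec_two_pow.comp (Primrec.succ.comp
        (Primrec.nat_add.comp hn Primrec.snd))) (Primrec.const 1))
  exact Primrec.list_map (Primrec.list_range.comp Primrec.list_length)
    (primrec_pointIdx true (Primrec.list_drop.comp (Primrec.nat_sub.comp hn Primrec.snd)
      Primrec.fst) hq).to₂

theorem forall_mem_branchIdx_iff (x : Str) (ν : PMF Str) :
    (∀ i ∈ branchIdx x, ν ∈ measSubbase i) ↔ ∀ j < x.length,
      (1 - (2⁻¹ : ℝ) ^ x.length) * (2⁻¹ : ℝ) ^ (j + 1) < (ν (x.drop (x.length - j))).toReal := by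
  have h : ∀ n j : ℕ, ((ratOf (((2 ^ n - 1 : ℕ) : ℤ), 2 ^ (n + j + 1) - 1) : ℚ) : ℝ) =
      (1 - (2⁻¹ : ℝ) ^ n) * (2⁻¹ : ℝ) ^ (j + 1) := by
    intro n j
    simp only [ratOf]
    push_cast [Nat.cast_sub Nat.one_le_two_pow]
    rw [sub_add_cancel, add_assoc, pow_add (2 : ℝ) n, inv_pow, inv_pow]
    field_simp
  simp only [branchIdx, List.mem_map, List.mem_range, forall_exists_index, and_imp,
    forall_apply_eq_imp_iff₂, mem_pointIdx_true, h]

/-- The function that takes the value `|x| + 1` at `x` if the conditions `branchIdx x` hold. -/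
noncomputable def branchTest (ν : PMF Str) (x : Str) : ℝ≥0∞ :=
  ⨆ (_ : ∀ i ∈ branchIdx x, ν ∈ measSubbase i), ((x.length + 1 : ℕ) : ℝ≥0∞)

theorem enumerates_branchTest : ∃ R, Enumerates R branchTest := by
  refine ⟨fun z => ratOf z.2.2 < 0 ∨ (z.1 = branchIdx z.2.1 ∧
    ratOf z.2.2 < ((z.2.1.length + 1 : ℕ) : ℚ)), ?_, ?_⟩
  · have hq : Primrec fun z : List MeasIdx × Str × (ℤ × ℕ) => z.2.2 :=
      Primrec.snd.comp Primrec.snd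
    have hx : Primrec fun z : List MeasIdx × Str × (ℤ × ℕ) => z.2.1 :=
      Primrec.fst.comp Primrec.snd
    exact rePred_of_primrecPred ((primrecPred_ratOf_neg.comp hq).or
      ((Primrec.eq.comp Primrec.fst (primrec_branchIdx.comp hx)).and
        (primrecPred_ratOf_lt_natCast_succ.comp hq (Primrec.list_length.comp hx))))
  · intro ν x q
    have hneg : ((ratOf q : ℚ) : ℝ) < 0 ↔ ratOf q < 0 := by exact_mod_cast Iff.rfl
    have hlt : ENNReal.ofReal ((ratOf q : ℚ) : ℝ) < ((x.length + 1 : ℕ) : ℝ≥0∞) ↔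
        ratOf q < ((x.length + 1 : ℕ) : ℚ) := by
      rw [← ENNReal.ofReal_natCast, ENNReal.ofReal_lt_ofReal_iff (by positivity)]
      exact_mod_cast Iff.rfl
    rw [coe_lt_coe_ennreal_iff, hneg, branchTest, lt_iSup_iff, exists_prop, hlt]
    constructor
    · rintro (h | ⟨hν, h⟩)
      · exact ⟨[], Or.inl h, by simp⟩
      · exact ⟨_, Or.inr ⟨rfl, h⟩, hν⟩
    · rintro ⟨w, h | ⟨hw, h⟩, hν⟩
      · exact Or.inl h
      · dsimp only at hw; subst hw
        exact Or.inr ⟨hν, h⟩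

theorem sum_range_inv_two_pow_succ (n : ℕ) :
    ∑ j ∈ Finset.range n, (2⁻¹ : ℝ) ^ (j + 1) = 1 - (2⁻¹ : ℝ) ^ n := by
  induction n with
  | zero => simp
  | succ n ih => rw [Finset.sum_range_succ, ih, pow_succ]; ring

/-- If the proper suffixes of one string of length `n` carry almost all the mass that `2 ^ (-j-1)`
at length `j` leaves possible, then only `O (2 ^ (-n))` is left for the strings of length `n`. -/
theorem tsum_branch_le (ν : PMF Str) (n : ℕ) :
    ∑' x, Set.indicator {x : Str | x.length = n ∧ ∀ i ∈ branchIdx x, ν ∈ measSubbase i} ν x ≤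
      ENNReal.ofReal (2 * (2⁻¹ : ℝ) ^ n) := by
  classical
  set U := {x : Str | x.length = n ∧ ∀ i ∈ branchIdx x, ν ∈ measSubbase i} with hU
  rcases U.eq_empty_or_nonempty with h | ⟨x₀, hx₀⟩
  · simp [h]
  obtain ⟨hlen, hx₀⟩ := hx₀
  rw [forall_mem_branchIdx_iff, hlen] at hx₀
  -- The proper suffixes of `x₀`, by length. They are disjoint from `U`, and carry mass close to `1`.
  let s : ℕ → Str := fun j => x₀.drop (n - j)
  have hs : ∀ j < n, (s j).length = j := by
    intro j hj; simp only [s, List.length_drop, hlen]; omega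
  let S : Finset Str := (Finset.range n).image s
  have hsum : (1 - (2⁻¹ : ℝ) ^ n) * (1 - (2⁻¹ : ℝ) ^ n) ≤ ∑ y ∈ S, (ν y).toReal := by
    rw [Finset.sum_image, ← sum_range_inv_two_pow_succ n, Finset.mul_sum]
    · rw [sum_range_inv_two_pow_succ n]
      exact Finset.sum_le_sum fun j hj => (hx₀ j (Finset.mem_range.1 hj)).le
    · intro i hi j hj hij
      rw [← hs i (by simpa using hi), ← hs j (by simpa using hj), hij]
  have htot : ∑' x, U.indicator ν x + ∑ y ∈ S, ν y ≤ 1 := by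
    have h1 : ∑ y ∈ S, ν y = ∑' x, (S : Set Str).indicator ν x :=
      (sum_eq_tsum_indicator _ _)
    rw [h1, ← ENNReal.tsum_add, ← ν.tsum_coe]
    refine ENNReal.tsum_le_tsum fun x => ?_
    by_cases hx : x ∈ U
    · have hxS : x ∉ (S : Set Str) := by
        intro h
        obtain ⟨j, hj, rfl⟩ := Finset.mem_image.1 (Finset.mem_coe.1 h)
        have h1 := hs j (Finset.mem_range.1 hj)
        have h2 : (s j).length = n := hx.1
        have := Finset.mem_range.1 hj
        omega
      simp [hx, hxS]
    · rw [Set.indicator_of_notMem hx, zero_add]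
      exact Set.indicator_le_self _ _ _
  have hfin : ∑' x, U.indicator ν x ≠ ⊤ :=
    ne_top_of_le_ne_top ENNReal.one_ne_top (le_trans le_self_add htot)
  have hfin' : ∀ y ∈ S, ν y ≠ ⊤ := fun y _ => ν.apply_ne_top y
  have hreal := ENNReal.toReal_mono ENNReal.one_ne_top htot
  rw [ENNReal.toReal_add hfin (ENNReal.sum_ne_top.2 hfin'), ENNReal.toReal_sum hfin',
    ENNReal.toReal_one] at hreal
  rw [← ENNReal.ofReal_toReal hfin]
  refine ENNReal.ofReal_le_ofReal ?_
  nlinarith [sq_nonneg ((2⁻¹ : ℝ) ^ n)]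

theorem tsum_mul_branchTest_le : ∃ K : ℕ, 0 < K ∧ ∀ ν : PMF Str,
    ∑' x, ν x * branchTest ν x ≤ K := by
  classical
  have hsummable : Summable fun n : ℕ => ((n + 1 : ℕ) : ℝ) * (2 * (2⁻¹ : ℝ) ^ n) := by
    have h1 : Summable fun n : ℕ => (n : ℝ) * (2⁻¹ : ℝ) ^ n := by
      simpa using summable_pow_mul_geometric_of_norm_lt_one 1
        (r := (2⁻¹ : ℝ)) (by norm_num)
    have h2 : Summable fun n : ℕ => (2⁻¹ : ℝ) ^ n :=
      summable_geometric_of_lt_one (by norm_num) (by norm_num)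
    refine ((h1.add h2).mul_left 2).congr fun n => ?_
    push_cast; ring
  obtain ⟨K, hK⟩ := exists_nat_ge (∑' n : ℕ, ((n + 1 : ℕ) : ℝ) * (2 * (2⁻¹ : ℝ) ^ n))
  refine ⟨K + 1, Nat.succ_pos K, fun ν => ?_⟩
  let U : ℕ → Set Str := fun n => {x | x.length = n ∧ ∀ i ∈ branchIdx x, ν ∈ measSubbase i}
  calc ∑' x, ν x * branchTest ν x
      ≤ ∑' x, ∑' n : ℕ, ((n + 1 : ℕ) : ℝ≥0∞) * (U n).indicator ν x := by
        refine ENNReal.tsum_le_tsum fun x => ?_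
        unfold branchTest
        rw [ENNReal.mul_iSup]
        refine iSup_le fun hx => le_trans (le_of_eq ?_) (ENNReal.le_tsum x.length)
        rw [Set.indicator_of_mem (show x ∈ U x.length from ⟨rfl, hx⟩), mul_comm]
    _ = ∑' n : ℕ, ((n + 1 : ℕ) : ℝ≥0∞) * ∑' x, (U n).indicator ν x := by
        rw [ENNReal.tsum_comm]
        exact tsum_congr fun n => ENNReal.tsum_mul_left
    _ ≤ ∑' n : ℕ, ENNReal.ofReal (((n + 1 : ℕ) : ℝ) * (2 * (2⁻¹ : ℝ) ^ n)) := by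
        refine ENNReal.tsum_le_tsum fun n => ?_
        rw [ENNReal.ofReal_mul (by positivity), ENNReal.ofReal_natCast]
        exact mul_le_mul_right (tsum_branch_le ν n) _
    _ = ENNReal.ofReal (∑' n : ℕ, ((n + 1 : ℕ) : ℝ) * (2 * (2⁻¹ : ℝ) ^ n)) :=
        (ENNReal.ofReal_tsum_of_nonneg (fun n => by positivity) hsummable).symm
    _ ≤ ((K + 1 : ℕ) : ℝ≥0∞) := by
        rw [← ENNReal.ofReal_natCast]
        exact ENNReal.ofReal_le_ofReal (hK.trans (by push_cast; linarith))

/-- A universal test detects that almost all of the mass lies on the suffixes of `x`: its value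
there is at least of the order of the length. -/
theorem IsUniversalTest.length_le {t : PMF Str → Str → ℝ≥0∞} (ht : IsUniversalTest t) :
    ∃ c : ℝ≥0, 0 < c ∧ ∀ (ν : PMF Str) (x : Str), (∀ j < x.length,
      (1 - (2⁻¹ : ℝ) ^ x.length) * (2⁻¹ : ℝ) ^ (j + 1) < (ν (x.drop (x.length - j))).toReal) →
        (c : ℝ≥0∞) * ((x.length + 1 : ℕ) : ℝ≥0∞) ≤ t ν x := by
  obtain ⟨R, hR⟩ := enumerates_branchTest
  obtain ⟨K, hK, hle⟩ := tsum_mul_branchTest_le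
  obtain ⟨c, hc, h⟩ := ht.dominates hR K hK hle
  refine ⟨c, hc, fun ν x hx => le_trans (mul_le_mul_right ?_ _) (h ν x)⟩
  exact le_iSup_of_le ((forall_mem_branchIdx_iff x ν).2 hx) le_rfl

/-! ### The Kraft inequality for prefix-free sets -/

theorem uniquelyDecodable_of_prefixFree {S : Set Str} (h0 : [] ∉ S)
    (hS : ∀ p ∈ S, ∀ q ∈ S, p ≠ q → ¬ p <+: q) : InformationTheory.UniquelyDecodable S := by
  intro L₁
  induction L₁ with
  | nil =>
    rintro (_ | ⟨w, L₂⟩) - h2 h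
    · rfl
    · simp only [List.flatten_nil, List.flatten_cons, List.nil_eq, List.append_eq_nil_iff] at h
      exact absurd (h.1 ▸ h2 w List.mem_cons_self) h0
  | cons v L₁ ih =>
    rintro (_ | ⟨w, L₂⟩) h1 h2 h
    · simp only [List.flatten_nil, List.flatten_cons, List.append_eq_nil_iff] at h
      exact absurd (h.1 ▸ h1 v List.mem_cons_self) h0
    · simp only [List.flatten_cons] at h
      have hv := h1 v List.mem_cons_self
      have hw := h2 w List.mem_cons_self
      have hvw : v = w := by
        by_contra hne
        rcases List.prefix_or_prefix_of_prefix (List.prefix_append v L₁.flatten)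
          (h ▸ List.prefix_append w L₂.flatten) with h' | h'
        · exact hS v hv w hw hne h'
        · exact hS w hw v hv (Ne.symm hne) h'
      subst hvw
      rw [ih L₂ (fun u hu => h1 u (List.mem_cons_of_mem _ hu))
        (fun u hu => h2 u (List.mem_cons_of_mem _ hu)) (List.append_cancel_left h)]

theorem tsum_prefixFree_le_one {S : Set Str} (hS : ∀ p ∈ S, ∀ q ∈ S, p ≠ q → ¬ p <+: q) :
    ∑' p, S.indicator (fun p : Str => (2⁻¹ : ℝ≥0∞) ^ p.length) p ≤ 1 := by
  classical
  -- The code `{[]}` is prefix-free but not uniquely decodable.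
  by_cases h0 : [] ∈ S
  · have : S = {[]} := by
      ext p
      constructor
      · intro hp
        by_contra hne
        exact hS [] h0 p hp (Ne.symm hne) List.nil_prefix
      · rintro rfl; exact h0
    rw [this, tsum_eq_single []]
    · simp
    · intro p hp; simp [hp]
  · rw [ENNReal.tsum_eq_iSup_sum]
    refine iSup_le fun F => ?_
    rw [← Finset.sum_filter_add_sum_filter_not F (· ∈ S),
      Finset.sum_eq_zero (s := F.filter (· ∉ S))
        (fun p hp => Set.indicator_of_notMem (Finset.mem_filter.1 hp).2 _), add_zero,
      Finset.sum_congr rfl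
        (fun p hp => Set.indicator_of_mem (Finset.mem_filter.1 hp).2 _)]
    have hud : InformationTheory.UniquelyDecodable ((F.filter (· ∈ S) : Finset Str) : Set Str) := by
      apply uniquelyDecodable_of_prefixFree
      · simp [h0]
      · intro p hp q hq
        exact hS p (Finset.mem_filter.1 (Finset.mem_coe.1 hp)).2 q
          (Finset.mem_filter.1 (Finset.mem_coe.1 hq)).2
    have hk := InformationTheory.kraft_mcmillan_inequality hud
    rw [← ENNReal.toReal_le_toReal (by simp) ENNReal.one_ne_top, ENNReal.toReal_sum (by simp)]
    simpa using hk

/-! ### A branch of incompressible strings -/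

/-- The a priori probability of `x`: the total weight `2 ^ (-|p|)` of the programs for `x`. -/
noncomputable def programWeight (A : Str → Str →. Str) (x : Str) : ℝ≥0∞ :=
  ∑' p : Str, Set.indicator {p | x ∈ A p []} (fun p : Str => (2⁻¹ : ℝ≥0∞) ^ p.length) p

theorem le_programWeight {A : Str → Str →. Str} {x p : Str} (h : x ∈ A p []) :
    (2⁻¹ : ℝ≥0∞) ^ p.length ≤ programWeight A x := by
  refine le_trans (le_of_eq ?_) (ENNReal.le_tsum p)
  rw [Set.indicator_of_mem (by exact h)]

theorem IsInterpreter.tsum_programWeight_le {A : Str → Str →. Str} (hA : IsInterpreter A) :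
    ∑' x, programWeight A x ≤ 1 := by
  classical
  unfold programWeight
  rw [ENNReal.tsum_comm]
  refine le_trans (ENNReal.tsum_le_tsum fun p => ?_)
    (tsum_prefixFree_le_one (S := {p | (A p []).Dom}) fun p hp q hq => hA.prefixFree [] p q hp hq)
  by_cases hp : (A p []).Dom
  · rw [tsum_eq_single ((A p []).get hp)]
    · rw [Set.indicator_of_mem (s := {p | (A p []).Dom}) (by exact hp)]
      exact Set.indicator_le_self _ _ _
    · intro x hx
      refine Set.indicator_of_notMem (fun h => hx ?_) _
      exact Part.mem_unique h (Part.get_mem hp)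
  · have h0 : ∀ x, Set.indicator {p | x ∈ A p []} (fun p : Str => (2⁻¹ : ℝ≥0∞) ^ p.length) p = 0 :=
      fun x => Set.indicator_of_notMem (s := {p | x ∈ A p []})
        (fun h => hp (Part.dom_iff_mem.2 ⟨x, h⟩)) _
    rw [ENNReal.tsum_eq_zero.2 h0]
    exact zero_le

theorem countable_partrec (α β : Type) [Primcodable α] [Primcodable β] :
    {f : α →. β | Partrec f}.Countable := by
  have h : ∀ f : {f : α →. β | Partrec f}, ∃ c : Nat.Partrec.Code,
      c.eval = fun n => Part.bind (Encodable.decode (α := α) n) fun a =>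
        (f.1 a).map Encodable.encode :=
    fun f => Nat.Partrec.Code.exists_code.1 f.2
  choose c hc using h
  refine Set.countable_coe_iff.1 (Function.Injective.countable (f := c) fun f g hfg => ?_)
  ext1
  funext a
  have h1 := congrFun ((hc f).symm.trans ((congrArg _ hfg).trans (hc g))) (Encodable.encode a)
  simp only [Encodable.encodek, Part.coe_some, Part.bind_some] at h1
  ext b
  have h2 := Part.ext_iff.1 h1 (Encodable.encode b)
  simpa [Part.mem_map_iff] using h2

theorem countable_interpreters : {A : Str → Str →. Str | IsInterpreter A}.Countable := by
  refine ((countable_partrec (Str × Str) Str).preimage_of_injOn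
    (f := fun (A : Str → Str →. Str) (z : Str × Str) => A z.1 z.2) ?_).mono ?_
  · intro A _ B _ h
    funext p y
    exact congrFun h (p, y)
  · exact fun A hA => hA.partrec

/-- The sequence `s` runs through the suffixes of an infinite string (growing to the left). -/
structure IsBranch (s : ℕ → Str) : Prop where
  zero : s 0 = []
  succ : ∀ n, ∃ b, s (n + 1) = b :: s n

/-- Along some branch, a semimeasure on strings never exceeds the uniform distribution: always
pass to the child whose subtree has the smaller mass. -/
theorem exists_branch_le {m : Str → ℝ≥0∞} (hm : ∑' x, m x ≤ 1) :
    ∃ s, IsBranch s ∧ ∀ n, m (s n) ≤ (2⁻¹ : ℝ≥0∞) ^ n := by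
  classical
  let V : Str → ℝ≥0∞ := fun x => ∑' y, Set.indicator {y | x <:+ y} m y
  have hV : ∀ x, V (true :: x) + V (false :: x) ≤ V x := by
    intro x
    simp only [V]
    rw [← ENNReal.tsum_add]
    refine ENNReal.tsum_le_tsum fun y => ?_
    by_cases h1 : true :: x <:+ y
    · have h2 : ¬ false :: x <:+ y := by
        intro h2
        have := (List.suffix_of_suffix_length_le h1 h2 (by simp)).eq_of_length (by simp)
        simp at this
      have h3 : x <:+ y := (List.suffix_cons _ _).trans h1
      simp [h1, h2, h3]
    · by_cases h2 : false :: x <:+ y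
      · have h3 : x <:+ y := (List.suffix_cons _ _).trans h2
        simp [h1, h2, h3]
      · simp [h1, h2]
  have hstep : ∀ x, ∃ b, V (b :: x) ≤ 2⁻¹ * V x := by
    intro x
    by_contra! h
    have h1 := ENNReal.add_lt_add (h true) (h false)
    rw [← add_mul, ENNReal.inv_two_add_inv_two, one_mul] at h1
    exact absurd (hV x) (not_le.2 h1)
  choose b hb using hstep
  let s : ℕ → Str := fun n => Nat.rec [] (fun _ x => b x :: x) n
  refine ⟨s, ⟨rfl, fun n => ⟨b (s n), rfl⟩⟩, fun n => ?_⟩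
  have h1 : V (s n) ≤ (2⁻¹ : ℝ≥0∞) ^ n := by
    induction n with
    | zero =>
      refine le_trans (ENNReal.tsum_le_tsum fun y => ?_) (hm.trans (by simp))
      exact Set.indicator_le_self _ _ _
    | succ n ih =>
      rw [pow_succ']
      exact (hb (s n)).trans (mul_le_mul_right ih _)
  refine le_trans (le_trans (le_of_eq ?_) (ENNReal.le_tsum (s n))) h1
  rw [Set.indicator_of_mem (by exact List.suffix_rfl)]

/-- There is a branch all of whose members are incompressible, for every interpreter. -/
theorem exists_incompressible_branch : ∃ s, IsBranch s ∧ ∀ A, IsInterpreter A →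
    ∃ c : ℕ, ∀ n : ℕ, (n : ℕ∞) ≤ condComplexity A (s n) [] + c := by
  classical
  obtain ⟨e, he⟩ := countable_interpreters.exists_injective_nat
  let m : Str → ℝ≥0∞ := fun x => ∑' A : {A : Str → Str →. Str | IsInterpreter A},
    (2⁻¹ : ℝ≥0∞) ^ (e A + 1) * programWeight A x
  have hm : ∑' x, m x ≤ 1 := by
    simp only [m]
    rw [ENNReal.tsum_comm]
    calc ∑' A : {A : Str → Str →. Str | IsInterpreter A}, ∑' x,
          (2⁻¹ : ℝ≥0∞) ^ (e A + 1) * programWeight A x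
        ≤ ∑' A : {A : Str → Str →. Str | IsInterpreter A}, (2⁻¹ : ℝ≥0∞) ^ (e A + 1) := by
          refine ENNReal.tsum_le_tsum fun A => ?_
          rw [ENNReal.tsum_mul_left]
          exact mul_le_of_le_one_right' (IsInterpreter.tsum_programWeight_le A.2)
      _ ≤ ∑' n : ℕ, (2⁻¹ : ℝ≥0∞) ^ (n + 1) :=
          ENNReal.tsum_comp_le_tsum_of_injective he fun n => (2⁻¹ : ℝ≥0∞) ^ (n + 1)
      _ ≤ 1 := by
          rw [ENNReal.tsum_geometric_add_one, ENNReal.one_sub_inv_two, inv_inv]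
          exact ENNReal.inv_mul_le_one 2
  obtain ⟨s, hs, hle⟩ := exists_branch_le hm
  refine ⟨s, hs, fun A hA => ⟨e ⟨A, hA⟩ + 1, fun n => ?_⟩⟩
  -- A program `p` for `s n` contributes `2 ^ (-i - 1 - |p|)` to `m (s n) ≤ 2 ^ (-n)`.
  rw [← tsub_le_iff_right]
  refine le_iInf₂ fun p hp => ?_
  rw [tsub_le_iff_right]
  have h1 : (2⁻¹ : ℝ≥0∞) ^ (e ⟨A, hA⟩ + 1 + p.length) ≤ (2⁻¹ : ℝ≥0∞) ^ n := by
    rw [pow_add]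
    refine le_trans (mul_le_mul_right (le_programWeight hp) _) (le_trans ?_ (hle n))
    exact ENNReal.le_tsum (f := fun A : {A : Str → Str →. Str | IsInterpreter A} =>
      (2⁻¹ : ℝ≥0∞) ^ (e A + 1) * programWeight A (s n)) ⟨A, hA⟩
  have h2 : n ≤ e ⟨A, hA⟩ + 1 + p.length := by
    rw [← ENNReal.inv_pow, ← ENNReal.inv_pow, ENNReal.inv_le_inv] at h1
    exact (Nat.pow_le_pow_iff_right (a := 2) (by norm_num)).1 (by exact_mod_cast h1)
  rw [add_comm (p.length : ℕ∞)]
  exact_mod_cast h2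

/-! ### Interpreters reading unary codes -/

/-- The self-delimiting unary code `1 ⋯ 1 0` of a natural number. -/
def unary : ℕ → Str
  | 0 => [false]
  | k + 1 => true :: unary k

theorem length_unary (k : ℕ) : (unary k).length = k + 1 := by
  induction k with
  | zero => rfl
  | succ k ih => simp [unary, ih]

theorem eq_of_unary_prefix : ∀ {k l : ℕ}, unary k <+: unary l → k = l
  | 0, 0, _ => rfl
  | 0, _ + 1, h => by simp [unary] at h
  | _ + 1, 0, h => by simp [unary] at h
  | k + 1, l + 1, h => by
    rw [unary, unary, List.cons_prefix_cons] at h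
    rw [eq_of_unary_prefix h.2]

theorem primrec_unary : Primrec unary :=
  (Primrec.nat_rec₁ [false] (Primrec.list_cons.comp (Primrec.const true)
    Primrec.snd).to₂).of_eq fun n => by
      induction n with
      | zero => rfl
      | succ n ih => rw [unary, ← ih]

/-- A partial computable sequence of strings can be described by the unary codes of its indices. -/
theorem exists_unary_interpreter {f : ℕ →. Str} (hf : Partrec f) :
    ∃ A, IsInterpreter A ∧ ∀ k, ∀ x ∈ f k, condComplexity A x [] ≤ (k + 1 : ℕ) := by
  let A : Str → Str →. Str := fun p _ =>
    bif decide (p = unary (p.length - 1)) then f (p.length - 1) else Part.none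
  have hdom : ∀ p y, (A p y).Dom → p = unary (p.length - 1) := by
    intro p y h
    by_contra hne
    simp [A, hne] at h
  have hk : Computable fun z : Str × Str => z.1.length - 1 :=
    (Primrec.nat_sub.comp (Primrec.list_length.comp Primrec.fst) (Primrec.const 1)).to_comp
  refine ⟨A, ⟨?_, ?_⟩, ?_⟩
  · refine Partrec.cond ?_ (hf.comp hk) Partrec.none
    exact (Primrec.eq.comp Primrec.fst (primrec_unary.comp (Primrec.nat_sub.comp
      (Primrec.list_length.comp Primrec.fst) (Primrec.const 1)))).decide.to_comp
  · intro y p q hp hq hne hpq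
    have hp' := hdom p y hp
    have hq' := hdom q y hq
    rw [hp', hq'] at hpq
    exact hne (hp'.trans ((congrArg unary (eq_of_unary_prefix hpq)).trans hq'.symm))
  · intro k x hx
    have h : x ∈ A (unary k) [] := by simpa [A, length_unary] using hx
    exact (iInf₂_le (unary k) h).trans (by rw [length_unary])

theorem primrec_bits : Primrec Nat.bits := by
  -- Course-of-values recursion: `l` lists the values at `0, …, l.length - 1`.
  let g : Unit → List Str → Option Str := fun _ l =>
    some (if l.length = 0 then [] else l.length.bodd :: l.getI l.length.div2)
  have hg : Primrec₂ g := by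
    have hl : Primrec fun z : Unit × List Str => z.2.length :=
      Primrec.list_length.comp Primrec.snd
    exact Primrec.option_some.comp (Primrec.ite (Primrec.eq.comp hl (Primrec.const 0))
      (Primrec.const []) (Primrec.list_cons.comp (Primrec.nat_bodd.comp hl)
        (Primrec.list_getI.comp Primrec.snd (Primrec.nat_div2.comp hl))))
  have h : Primrec₂ fun (_ : Unit) n => Nat.bits n := by
    refine Primrec.nat_strong_rec _ hg fun _ n => ?_
    simp only [g, List.length_map, List.length_range]
    rcases Nat.eq_zero_or_pos n with rfl | hn
    · simp
    · have hlt : n.div2 < n := by rw [Nat.div2_val]; omega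
      rw [if_neg hn.ne', List.getI_eq_getElem _ (by simpa using hlt)]
      have := Nat.bits_append_bit n.div2 n.bodd (fun h0 => by
        by_contra hb
        rw [Bool.not_eq_true] at hb
        have := Nat.bit_bodd_div2 n
        rw [h0, hb] at this
        exact hn.ne' (by simpa using this.symm))
      rw [Nat.bit_bodd_div2] at this
      simp [this]
  exact h.comp (Primrec.const ()) Primrec.id

/-- The crude bound `H n ≤ n + O(1)`. -/
theorem IsOptimal.condComplexity_bits_le {T : Str → Str →. Str} (hT : IsOptimal T) :
    ∃ c : ℕ, ∀ n : ℕ, condComplexity T (Nat.bits n) [] ≤ (n + c : ℕ) := by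
  obtain ⟨A, hA, hle⟩ := exists_unary_interpreter (f := fun n => Part.some (Nat.bits n))
    primrec_bits.to_comp
  obtain ⟨c, hc⟩ := hT.optimal A hA
  refine ⟨1 + c, fun n => (hc _ _).trans ?_⟩
  refine le_trans (add_le_add_left (hle n _ (Part.mem_some _)) _) ?_
  push_cast
  rw [add_assoc]

/-! ### The measure of a branch -/

section BranchMeasure

variable {s : ℕ → Str}

theorem IsBranch.length (hs : IsBranch s) (n : ℕ) : (s n).length = n := by
  induction n with
  | zero => simp [hs.zero]
  | succ n ih => obtain ⟨b, hb⟩ := hs.succ n; simp [hb, ih]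

theorem IsBranch.drop (hs : IsBranch s) (n j : ℕ) : (s (j + n)).drop n = s j := by
  induction n with
  | zero => rfl
  | succ n ih => obtain ⟨b, hb⟩ := hs.succ (j + n); rw [← add_assoc, hb, List.drop_succ_cons, ih]

theorem IsBranch.injective (hs : IsBranch s) : Function.Injective s := fun m n h => by
  rw [← hs.length m, ← hs.length n, h]

open Classical in
/-- The measure that gives weight `2 ^ (-n - 1)` to the member of length `n` of the branch `s`. -/
noncomputable def branchMeasure (hs : IsBranch s) : PMF Str :=
  ⟨fun x => if x = s x.length then (2⁻¹ : ℝ≥0∞) ^ (x.length + 1) else 0, by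
    rw [ENNReal.summable.hasSum_iff]
    rw [← hs.injective.tsum_eq]
    · simp only [hs.length, if_true]
      rw [ENNReal.tsum_geometric_add_one, ENNReal.one_sub_inv_two, inv_inv]
      exact ENNReal.inv_mul_cancel (by norm_num) (by norm_num)
    · intro x hx
      by_contra h
      exact hx (if_neg fun hx' => h ⟨_, hx'.symm⟩)⟩

theorem branchMeasure_apply (hs : IsBranch s) (n : ℕ) :
    branchMeasure hs (s n) = (2⁻¹ : ℝ≥0∞) ^ (n + 1) := by
  change (if s n = s (s n).length then (2⁻¹ : ℝ≥0∞) ^ ((s n).length + 1) else 0) = _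
  rw [hs.length, if_pos rfl]

theorem eq_of_branchMeasure_ne_zero (hs : IsBranch s) {x : Str} (hx : branchMeasure hs x ≠ 0) :
    x = s x.length := by
  by_contra h
  exact hx (if_neg h)

/-- From a computable branch measure the branch itself could be computed, and so its member of
length `2 * k` would be described by the unary code of `k`. -/
theorem not_isComputableMeasure_branchMeasure (hs : IsBranch s)
    (hinc : ∀ A, IsInterpreter A → ∃ c : ℕ, ∀ n : ℕ, (n : ℕ∞) ≤ condComplexity A (s n) [] + c) :
    ¬ IsComputableMeasure (branchMeasure hs) := by
  intro hcomp
  have hre : REPred fun z : ℕ × Str => z.2.length = 2 * z.1 ∧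
      branchMeasure hs ∈ measSubbase (pointIdx true z.2 (0, 0)) := by
    refine rePred_and (rePred_of_primrecPred ?_) ?_
    · exact Primrec.eq.comp (Primrec.list_length.comp Primrec.snd)
        (Primrec.nat_mul.comp (Primrec.const 2) Primrec.fst)
    · exact rePred_comp hcomp (primrec_pointIdx true Primrec.snd (Primrec.const (0, 0))).to_comp
  have hpos : ∀ x, branchMeasure hs ∈ measSubbase (pointIdx true x (0, 0)) ↔
      branchMeasure hs x ≠ 0 := by
    intro x
    rw [mem_pointIdx_true]
    simp [ratOf, ENNReal.toReal_pos_iff, pos_iff_ne_zero, PMF.apply_lt_top]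
  obtain ⟨f, hf, h1, h2⟩ := exists_partrec_of_rePred hre
  have hmem : ∀ k, s (2 * k) ∈ f k := by
    intro k
    have hd := h2 k ⟨s (2 * k), hs.length _, (hpos _).2 (by simp [branchMeasure_apply])⟩
    obtain ⟨hl, hx⟩ := h1 k _ (Part.get_mem hd)
    have heq := eq_of_branchMeasure_ne_zero hs ((hpos _).1 hx)
    dsimp only at hl
    rw [hl] at heq
    exact heq ▸ Part.get_mem hd
  obtain ⟨A, hA, hle⟩ := exists_unary_interpreter hf
  obtain ⟨c, hc⟩ := hinc A hA
  -- `2 * k ≤ k + 1 + c` fails for `k = c + 2`.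
  have h := (hc (2 * (c + 2))).trans (add_le_add_left (hle _ _ (hmem (c + 2))) _)
  have h' : 2 * (c + 2) ≤ c + 2 + 1 + c := by exact_mod_cast h
  omega

end BranchMeasure

/-! ### Deficiency and complexity along the branch -/

section Deficiency

variable {s : ℕ → Str} {t : PMF Str → Str → ℝ≥0∞}

theorem toReal_branchMeasure (hs : IsBranch s) (n : ℕ) :
    (branchMeasure hs (s n)).toReal = (2⁻¹ : ℝ) ^ (n + 1) := by
  rw [branchMeasure_apply]; simp

/-- Neither child is known in advance, so both maps `x ↦ b :: x` are used. -/
theorem IsUniversalTest.succ_le (ht : IsUniversalTest t) (hs : IsBranch s) :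
    ∃ c : ℝ≥0, 0 < c ∧
      ∀ k, (c : ℝ≥0∞) * t (branchMeasure hs) (s (k + 1)) ≤ t (branchMeasure hs) (s k) := by
  have hb : ∀ b : Bool, ∃ c : ℝ≥0, 0 < c ∧ ∀ (ν : PMF Str) (x : Str),
      (ν x).toReal < (2⁻¹ : ℝ) ^ x.length → (2⁻¹ : ℝ) ^ (x.length + 3) < (ν (b :: x)).toReal →
        (c : ℝ≥0∞) * t ν (b :: x) ≤ t ν x := fun b =>
    ht.shift_le (Primrec.list_cons.comp (Primrec.const b) Primrec.id) (List.cons_injective)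
  choose c hc h using hb
  refine ⟨min (c true) (c false), lt_min (hc true) (hc false), fun k => ?_⟩
  obtain ⟨b, hk⟩ := hs.succ k
  have hle : min (c true) (c false) ≤ c b := by
    cases b
    exacts [min_le_right _ _, min_le_left _ _]
  have h1 : (branchMeasure hs (s k)).toReal < (2⁻¹ : ℝ) ^ (s k).length := by
    rw [toReal_branchMeasure, hs.length]
    exact pow_lt_pow_right_of_lt_one₀ (by norm_num) (by norm_num) (Nat.lt_succ_self k)
  have h2 : (2⁻¹ : ℝ) ^ ((s k).length + 3) < (branchMeasure hs (b :: s k)).toReal := by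
    rw [← hk, toReal_branchMeasure, hs.length]
    exact pow_lt_pow_right_of_lt_one₀ (by norm_num) (by norm_num) (by omega)
  rw [hk]
  exact le_trans (mul_le_mul_left (ENNReal.coe_le_coe.2 hle) _) (h b _ _ h1 h2)

theorem IsUniversalTest.natCast_le (ht : IsUniversalTest t) (hs : IsBranch s) :
    ∃ c : ℝ≥0, 0 < c ∧
      ∀ k : ℕ, (c : ℝ≥0∞) * ((k + 1 : ℕ) : ℝ≥0∞) ≤ t (branchMeasure hs) (s k) := by
  obtain ⟨c, hc, h⟩ := ht.length_le
  refine ⟨c, hc, fun k => ?_⟩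
  have := h (branchMeasure hs) (s k) fun j hj => ?_
  · rwa [hs.length] at this
  · rw [hs.length] at hj ⊢
    have hd : (s k).drop (k - j) = s j := by
      have := hs.drop (k - j) j
      rwa [Nat.add_sub_cancel' hj.le] at this
    rw [hd, toReal_branchMeasure]
    have h1 : (0 : ℝ) < (2⁻¹ : ℝ) ^ k := by positivity
    have h2 : (0 : ℝ) < (2⁻¹ : ℝ) ^ (j + 1) := by positivity
    nlinarith

theorem IsTest.ne_top (ht : IsTest t) (hs : IsBranch s) (k : ℕ) :
    t (branchMeasure hs) (s k) ≠ ⊤ := by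
  intro h
  have h1 := (ENNReal.le_tsum (s k)).trans (ht.integral_le (branchMeasure hs))
  rw [h, ENNReal.mul_top (by simp [branchMeasure_apply])] at h1
  exact absurd h1 (by simp)

theorem log2_eq_coe {a : ℝ≥0∞} (h0 : a ≠ 0) (htop : a ≠ ⊤) :
    log2 a = ((Real.log a.toReal / Real.log 2 : ℝ) : EReal) := by
  rw [log2, ENNReal.log_pos_real h0 htop, EReal.coe_div]

/-- Along a branch the deficiency of randomness of the branch measure is a sequence of real
numbers that is unbounded but increases by a bounded amount in each step. -/
theorem IsUniversalTest.exists_deficiency_eq (ht : IsUniversalTest t) (hs : IsBranch s) :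
    ∃ D : ℕ → ℝ, (∀ k, deficiency t (branchMeasure hs) (s k) = (D k : EReal)) ∧
      (∃ S, ∀ k, D (k + 1) ≤ D k + S) ∧ ∀ B, ∃ k, B ≤ D k := by
  obtain ⟨c, hc, h1⟩ := ht.succ_le hs
  obtain ⟨c', hc', h2⟩ := ht.natCast_le hs
  have htop := ht.test.ne_top hs
  set u : ℕ → ℝ := fun k => (t (branchMeasure hs) (s k)).toReal with hu
  have h2' : ∀ k : ℕ, c' * ((k : ℝ) + 1) ≤ u k := by
    intro k
    have := ENNReal.toReal_mono (htop k) (h2 k)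
    rw [ENNReal.toReal_mul, ENNReal.toReal_natCast] at this
    simpa using this
  have hcpos : (0 : ℝ) < c := hc
  have hcpos' : (0 : ℝ) < c' := hc'
  have hpos : ∀ k, 0 < u k := fun k => lt_of_lt_of_le (by positivity) (h2' k)
  have h1' : ∀ k, c * u (k + 1) ≤ u k := by
    intro k
    have := ENNReal.toReal_mono (htop k) (h1 k)
    simpa using this
  have hlog2 : 0 < Real.log 2 := Real.log_pos (by norm_num)
  refine ⟨fun k => Real.log (u k) / Real.log 2, fun k => ?_, ⟨-Real.log c / Real.log 2, ?_⟩, ?_⟩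
  · refine log2_eq_coe (fun h => ?_) (htop k)
    have := hpos k
    simp [hu, h] at this
  · intro k
    rw [← add_div]
    refine div_le_div_of_nonneg_right ?_ hlog2.le
    have := Real.log_le_log (mul_pos hcpos (hpos (k + 1))) (h1' k)
    rw [Real.log_mul hcpos.ne' (hpos _).ne'] at this
    linarith
  · intro B
    obtain ⟨k, hk⟩ := exists_nat_ge (Real.exp (B * Real.log 2) / c')
    refine ⟨k, ?_⟩
    rw [le_div_iff₀ hlog2, Real.le_log_iff_exp_le (hpos k)]
    refine le_trans ?_ (h2' k)
    rw [div_le_iff₀ hcpos'] at hk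
    nlinarith

/-- A sequence that is unbounded above and increases by at most `S` in each step comes close to
every real number that is not far below its first term. -/
theorem exists_near {D : ℕ → ℝ} {S : ℝ} (hS : ∀ k, D (k + 1) ≤ D k + S) (hD : ∀ B, ∃ k, B ≤ D k)
    (v : ℝ) : ∃ k, v ≤ D k ∧ D k ≤ max (D 0) (v + S) := by
  classical
  refine ⟨Nat.find (hD v), Nat.find_spec (hD v), ?_⟩
  rcases hk : Nat.find (hD v) with _ | k
  · exact le_max_left _ _
  · have h := Nat.find_min (hD v) (m := k) (by omega)
    exact le_max_of_le_right ((hS k).trans (by linarith))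

theorem complexityFormula_le {T : Str → Str →. Str} (hs : IsBranch s) {c : ℕ}
    (hc : ∀ n : ℕ, (n : ℕ∞) ≤ condComplexity T (s n) [] + c) (k : ℕ) :
    complexityFormula T (branchMeasure hs) (s k) ≤ ((c + 1 : ℝ) : EReal) := by
  have hlog : log2 (branchMeasure hs (s k)) = ((-(k + 1) : ℝ) : EReal) := by
    rw [log2_eq_coe (by simp [branchMeasure_apply]) (PMF.apply_ne_top _ _), toReal_branchMeasure,
      Real.log_pow, Real.log_inv]
    have : Real.log 2 ≠ 0 := (Real.log_pos (by norm_num)).ne'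
    congr 1
    field_simp
    push_cast
    ring
  have hk := hc k
  rw [complexityFormula, H, hlog]
  cases hm : condComplexity T (s k) [] with
  | top => simp
  | coe m =>
    rw [hm] at hk
    have hk' : (k : ℝ) ≤ m + c := by exact_mod_cast hk
    have : (((m : ℕ∞) : ℝ≥0∞) : EReal) = ((m : ℝ) : EReal) := by
      simp; rfl
    rw [this, ← EReal.coe_neg, ← EReal.coe_sub, EReal.coe_le_coe_iff]
    linarith

theorem IsOptimal.exists_HNat_eq {T : Str → Str →. Str} (hT : IsOptimal T) :
    ∃ c : ℕ, ∀ n : ℕ, ∃ m : ℝ, HNat T n = (m : EReal) ∧ m ≤ n + c := by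
  obtain ⟨c, hc⟩ := hT.condComplexity_bits_le
  refine ⟨c, fun n => ?_⟩
  obtain ⟨m, hm⟩ := ENat.ne_top_iff_exists.1 (ne_top_of_le_ne_top (ENat.natCast_ne_top _) (hc n))
  have hmn := hc n
  rw [← hm] at hmn
  refine ⟨m, ?_, by exact_mod_cast hmn⟩
  rw [HNat, H, ← hm]
  simp; rfl

end Deficiency

end UniformTest

open UniformTest

theorem propositionp :
    ∃ μ : PMF UniformTest.Str,
      ¬ UniformTest.IsComputableMeasure μ ∧
      ∀ T : UniformTest.Str → UniformTest.Str →. UniformTest.Str, UniformTest.IsOptimal T →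
      ∀ t : PMF UniformTest.Str → UniformTest.Str → ℝ≥0∞, UniformTest.IsUniversalTest t →
        (∃ c : ℝ, ∀ n : ℕ, ∃ x : UniformTest.Str,
          (n : EReal) - UniformTest.HNat T n - (c : EReal) ≤ UniformTest.deficiency t μ x ∧
          UniformTest.deficiency t μ x ≤ (n : EReal) - UniformTest.HNat T n + (c : EReal) ∧
          UniformTest.complexityFormula T μ x ≤ (c : EReal)) ∧
        (∀ c : ℝ, ∃ x : UniformTest.Str,
          UniformTest.complexityFormula T μ x + (c : EReal) < UniformTest.deficiency t μ x) ∧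
        ¬ ∃ s : PMF UniformTest.Str → UniformTest.Str → ℝ≥0∞, UniformTest.IsUniversalTest s ∧
          ∀ (ν : PMF UniformTest.Str) (x : UniformTest.Str),
            UniformTest.log2 (s ν x) = UniformTest.complexityFormula T ν x := by
  obtain ⟨s, hs, hinc⟩ := exists_incompressible_branch
  refine ⟨branchMeasure hs, not_isComputableMeasure_branchMeasure hs hinc, fun T hT t ht => ?_⟩
  obtain ⟨c₁, hc₁⟩ := hinc T hT.interpreter
  have hformula := complexityFormula_le hs hc₁
  have hexceeds : ∀ t : PMF Str → Str → ℝ≥0∞, IsUniversalTest t → ∀ c : ℝ, ∃ x : Str,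
      complexityFormula T (branchMeasure hs) x + (c : EReal) <
        deficiency t (branchMeasure hs) x := by
    intro t ht c
    obtain ⟨D, hD, -, hunb⟩ := ht.exists_deficiency_eq hs
    obtain ⟨k, hk⟩ := hunb (c₁ + 1 + c + 1)
    refine ⟨s k, lt_of_le_of_lt (add_le_add_left (hformula k) _) ?_⟩
    rw [hD, ← EReal.coe_add, EReal.coe_lt_coe_iff]
    linarith
  refine ⟨?_, hexceeds t ht, ?_⟩
  · obtain ⟨D, hD, ⟨S, hS⟩, hunb⟩ := ht.exists_deficiency_eq hs
    obtain ⟨c₂, hc₂⟩ := hT.exists_HNat_eq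
    refine ⟨max (c₁ + 1 : ℝ) (max (D 0 + c₂ : ℝ) S), fun n => ?_⟩
    obtain ⟨m, hm, hmn⟩ := hc₂ n
    obtain ⟨k, hk₁, hk₂⟩ := exists_near hS hunb (n - m)
    have h₁ : (c₁ + 1 : ℝ) ≤ max (c₁ + 1 : ℝ) (max (D 0 + c₂ : ℝ) S) := le_max_left _ _
    have h₂ : D 0 + c₂ ≤ max (c₁ + 1 : ℝ) (max (D 0 + c₂ : ℝ) S) :=
      (le_max_left _ _).trans (le_max_right _ _)
    have h₃ : S ≤ max (c₁ + 1 : ℝ) (max (D 0 + c₂ : ℝ) S) :=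
      (le_max_right _ _).trans (le_max_right _ _)
    have h₀ : (0 : ℝ) ≤ c₁ := c₁.cast_nonneg
    have hn : ((n : ℕ) : EReal) = ((n : ℝ) : EReal) := rfl
    refine ⟨s k, ?_, ?_, (hformula k).trans (EReal.coe_le_coe_iff.2 h₁)⟩
    · rw [hD, hm, hn, ← EReal.coe_sub, ← EReal.coe_sub, EReal.coe_le_coe_iff]
      linarith
    · rw [hD, hm, hn, ← EReal.coe_sub, ← EReal.coe_add, EReal.coe_le_coe_iff]
      exact hk₂.trans (max_le (by linarith) (by linarith))
  · rintro ⟨u, hu, heq⟩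
    obtain ⟨x, hx⟩ := hexceeds u hu 0
    rw [deficiency, heq, EReal.coe_zero, add_zero] at hx
    exact lt_irrefl _ hx
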